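/- Let $N \ge 0$ and let $D^b(\mathbb{C}_{\mathbb{C}^N})$ be the bounded derived category of sheaves of $\mathbb{C}$-vector spaces on $\mathbb{C}^N$ (with its classical topology). Let $\mathcal{G} \in D^b(\mathbb{C}_{\mathbb{C}^N})$ be $\mathbb{C}$-constructible, i.e. there is a locally finite partition of $\mathbb{C}^N$ into nonempty subsets $S$, with $\overline{S}$ and $\overline{S} \setminus S$ closed complex analytic subsets of $\mathbb{C}^N$, such that $(H^j\mathcal{G})|_S$ is locally constant for all $S$ and all $j \in \mathbb{Z}$, and all stalks $(H^j\mathcal{G})_x$ are finite-dimensional. Assume that $\mathcal{G}$ is $\mathbb{R}_+$-conic, i.e. for every $j \in \mathbb{Z}$ the restriction of $H^j\mathcal{G}$ to every orbit $\mathbb{R}_+ x = \{t x : t \in \mathbb{R},\ t > 0\}$, $x \in \mathbb{C}^N$, is locally constant. Then $\mathcal{G}$ is monodromic, i.e. for every $j \in \mathbb{Z}$ the restriction of $H^j\mathcal{G}$ to every orbit $\mathbb{C}^* x = \{c x : c \in \mathbb{C},\ c \neq 0\}$, $x \in \mathbb{C}^N$, is locally constant. -/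

import Mathlib

open CategoryTheory TopologicalSpace

universe w

namespace ConicSheaf

/-- The category `Mod(ℂ_X)` of sheaves of `ℂ`-vector spaces on a topological space `X`. -/
abbrev Shv (X : TopCat.{0}) : Type 1 := TopCat.Sheaf (ModuleCat.{0} ℂ) X

/-- The restriction `F|_S` of a sheaf `F` on `X` to a subset `S` with the subspace topology:
the inverse image under the inclusion `S → X`. -/
noncomputable def restrict {X : TopCat.{0}} (F : Shv X) (S : Set X) : Shv (TopCat.of S) :=
  (TopCat.Sheaf.pullback (ModuleCat.{0} ℂ)
    (TopCat.ofHom ⟨((↑) : S → X), continuous_subtype_val⟩)).obj F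

/-- A sheaf on `X` is locally constant if every point has an open neighbourhood `U` such that
`F|_U` is isomorphic to the constant sheaf associated with some `ℂ`-vector space. -/
def IsLocallyConstantSheaf {X : TopCat.{0}} (F : Shv X) : Prop :=
  ∀ x : X, ∃ U : Opens X, x ∈ U ∧
    Sheaf.IsConstant (Opens.grothendieckTopology (TopCat.of (U : Set X)))
      (restrict F (U : Set X))

/-- The complex affine space `ℂ^N` with its usual (classical) topology. -/
noncomputable abbrev affineSpace (N : ℕ) : TopCat.{0} := TopCat.of (Fin N → ℂ)

/-- A (closed) complex analytic subset `Z` of `ℂ^N`: locally around every point of `ℂ^N` (not only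
around the points of `Z`), it is the zero set of finitely many holomorphic functions. -/
def IsComplexAnalyticSet {N : ℕ} (Z : Set (Fin N → ℂ)) : Prop :=
  ∀ x : Fin N → ℂ, ∃ U : Set (Fin N → ℂ), IsOpen U ∧ x ∈ U ∧
    ∃ (k : ℕ) (f : Fin k → (Fin N → ℂ) → ℂ),
      (∀ i, AnalyticOnNhd ℂ (f i) U) ∧ ∀ y ∈ U, y ∈ Z ↔ ∀ i, f i y = 0

/-- A complex analytic stratification of `ℂ^N`: a locally finite partition into (nonempty) subsets
`S` such that both `closure S` and `closure S \ S` are closed complex analytic subsets; in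
particular each `S` is locally closed.  Smoothness of the strata and the frontier condition may be
achieved by refining the partition and are not required here. -/
structure IsAnalyticStratification {N : ℕ} (𝒮 : Set (Set (Fin N → ℂ))) : Prop where
  isPartition : Setoid.IsPartition 𝒮
  locallyFinite : LocallyFinite (fun S : 𝒮 => (S : Set (Fin N → ℂ)))
  closure_analytic : ∀ S ∈ 𝒮, IsComplexAnalyticSet (closure S)
  boundary_analytic : ∀ S ∈ 𝒮, IsComplexAnalyticSet (closure S \ S)

section Complexes

variable {N : ℕ} [HasDerivedCategory.{w} (Shv (affineSpace N))]

/-- The `j`-th cohomology sheaf `H^j G` of an object `G` of the bounded derived category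
`D^b(ℂ_{ℂ^N})` of sheaves of `ℂ`-vector spaces on `ℂ^N`. -/
noncomputable def cohomologySheaf (G : DerivedCategory.Bounded (Shv (affineSpace N))) (j : ℤ) :
    Shv (affineSpace N) :=
  (DerivedCategory.homologyFunctor (Shv (affineSpace N)) j).obj G.obj

/-- `G ∈ D^b(ℂ_{ℂ^N})` is `ℂ`-constructible if there is a complex analytic stratification of `ℂ^N`
such that the restrictions of all cohomology sheaves of `G` to all strata are locally constant,
and the stalks of the cohomology sheaves are finite dimensional. -/
def IsCConstructible (G : DerivedCategory.Bounded (Shv (affineSpace N))) : Prop :=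
  (∃ 𝒮 : Set (Set (Fin N → ℂ)), IsAnalyticStratification 𝒮 ∧
    ∀ S ∈ 𝒮, ∀ j : ℤ, IsLocallyConstantSheaf (restrict (cohomologySheaf G j) S)) ∧
  ∀ (x : affineSpace N) (j : ℤ),
    Module.Finite ℂ ((cohomologySheaf G j).presheaf.stalk x)

/-- The orbit `ℝ_+ x` of `x ∈ ℂ^N` under multiplication by positive real numbers. -/
def posRealOrbit (x : Fin N → ℂ) : Set (Fin N → ℂ) :=
  {y | ∃ t : ℝ, 0 < t ∧ y = (t : ℂ) • x}

/-- The orbit `ℂ^* x` of `x ∈ ℂ^N` under multiplication by nonzero complex numbers. -/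
def complexOrbit (x : Fin N → ℂ) : Set (Fin N → ℂ) :=
  {y | ∃ c : ℂ, c ≠ 0 ∧ y = c • x}

/-- `G` is `ℝ_+`-conic: its cohomology sheaves are locally constant on every `ℝ_+`-orbit. -/
def IsConic (G : DerivedCategory.Bounded (Shv (affineSpace N))) : Prop :=
  ∀ (j : ℤ) (x : Fin N → ℂ),
    IsLocallyConstantSheaf (restrict (cohomologySheaf G j) (posRealOrbit x))

/-- `G` is monodromic: its cohomology sheaves are locally constant on every `ℂ^*`-orbit. -/
def IsMonodromic (G : DerivedCategory.Bounded (Shv (affineSpace N))) : Prop :=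
  ∀ (j : ℤ) (x : Fin N → ℂ),
    IsLocallyConstantSheaf (restrict (cohomologySheaf G j) (complexOrbit x))

end Complexes

end ConicSheaf

/-! For `x ≠ 0`, pull everything back along `z ↦ z • x`. Near any `c`, an analytic set contains or
misses a whole punctured disc about `c`. By local finiteness some punctured disc then lies in a
single stratum (`exists_eventually_mem`), where the sheaf is locally constant. Conicity gives a
frame at `c • x`: a linear family of sections on an ambient open set, inducing isomorphisms onto the
stalks along the nearby ray. That ray enters the punctured disc. Over a connected base a family that
is a frame at one point of a locally constant sheaf is a frame everywhere
(`isIso_germ_of_isFramedOn`), so the same sections frame the whole disc, centre included.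
Finite-dimensional stalks allow local constancy on a subset to be expressed by frames on ambient
open sets. -/

namespace ConicSheaf
open Opposite TopCat

/-! ### Inverse images through sections and stalks -/

/-- `G` is a sheaf on `Y` receiving sections from `F` along `k : Y ⟶ X`, compatibly with
isomorphisms `F_{k y} ≅ G_y` on stalks. -/
def IsStalkwisePullback {X Y : TopCat.{0}} (k : Y ⟶ X) (F : Shv X) (G : Shv Y) : Prop :=
  ∃ η : ∀ W : Opens X, F.presheaf.obj (op W) ⟶ G.presheaf.obj (op ((Opens.map k).obj W)),
    ∀ y : Y, ∃ e : F.presheaf.stalk (k y) ≅ G.presheaf.stalk y,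
      ∀ (W : Opens X) (hy : y ∈ (Opens.map k).obj W),
        F.presheaf.germ W (k y) hy ≫ e.hom =
          η W ≫ G.presheaf.germ ((Opens.map k).obj W) y hy

lemma isStalkwisePullback_pullback {X Y : TopCat.{0}} (f : Y ⟶ X) (F : Shv X) :
    IsStalkwisePullback f F ((Sheaf.pullback (ModuleCat.{0} ℂ) f).obj F) := by
  let P := (Presheaf.pullback (ModuleCat.{0} ℂ) f).obj F.presheaf
  let i : sheafify (Opens.grothendieckTopology Y) P ≅
      ((Sheaf.pullback (ModuleCat.{0} ℂ) f).obj F).presheaf :=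
    (sheafToPresheaf _ _).mapIso ((Sheaf.pullbackIso (ModuleCat.{0} ℂ) f).app F).symm
  let θ : P ⟶ ((Sheaf.pullback (ModuleCat.{0} ℂ) f).obj F).presheaf :=
    toSheafify (Opens.grothendieckTopology Y) P ≫ i.hom
  refine ⟨fun W => ((Presheaf.pullbackPushforwardAdjunction _ f).unit.app F.presheaf).app (op W) ≫
    θ.app (op ((Opens.map f).obj W)), fun y => ?_⟩
  have h1 : IsIso ((Presheaf.stalkFunctor (ModuleCat.{0} ℂ) y).map
      (toSheafify (Opens.grothendieckTopology Y) P)) :=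
    Presheaf.stalkFunctor_map_unit_toSheafify_isIso ..
  have h2 : IsIso ((Presheaf.stalkFunctor (ModuleCat.{0} ℂ) y).map θ) := by
    simp only [θ, Functor.map_comp]
    exact IsIso.comp_isIso' h1 inferInstance
  refine ⟨Presheaf.stalkPullbackIso _ f F.presheaf y ≪≫
    @asIso _ _ _ _ ((Presheaf.stalkFunctor (ModuleCat.{0} ℂ) y).map θ) h2, fun W hy => ?_⟩
  have := Presheaf.germ_stalkPullbackHom (ModuleCat.{0} ℂ) f F.presheaf y W hy
  simp only [Iso.trans_hom, Presheaf.stalkPullbackIso]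
  rw [reassoc_of% this]
  exact congrArg (fun k => ((Presheaf.pullbackPushforwardAdjunction (ModuleCat.{0} ℂ) f).unit.app
    F.presheaf).app (op W) ≫ k)
    (Presheaf.stalkFunctor_map_germ ((Opens.map f).obj W) y hy θ)

lemma IsStalkwisePullback.comp {X Y Z : TopCat.{0}} {f : Y ⟶ X} {g : Z ⟶ Y} {F : Shv X}
    {G : Shv Y} {H : Shv Z} (hf : IsStalkwisePullback f F G) (hg : IsStalkwisePullback g G H) :
    IsStalkwisePullback (g ≫ f) F H := by
  obtain ⟨η, hη⟩ := hf
  obtain ⟨ζ, hζ⟩ := hg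
  refine ⟨fun W => η W ≫ ζ ((Opens.map f).obj W), fun z => ?_⟩
  obtain ⟨e, he⟩ := hη (g z)
  obtain ⟨e', he'⟩ := hζ z
  refine ⟨e ≪≫ e', fun W hz => ?_⟩
  have h1 := he W hz
  have h2 := he' ((Opens.map f).obj W) hz
  calc F.presheaf.germ W (f (g z)) hz ≫ e.hom ≫ e'.hom
      = η W ≫ G.presheaf.germ ((Opens.map f).obj W) (g z) hz ≫ e'.hom := by
        rw [reassoc_of% h1]
    _ = η W ≫ ζ ((Opens.map f).obj W) ≫ H.presheaf.germ _ z hz := by rw [h2]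
    _ = _ := (Category.assoc _ _ _).symm

/-- The inclusion of an open subset of a subspace into the ambient space. -/
def inclusion {X : TopCat.{0}} (A : Set X) (U : Opens (TopCat.of A)) :
    TopCat.of (U : Set (TopCat.of A)) ⟶ X :=
  TopCat.ofHom ⟨fun y : (U : Set (TopCat.of A)) => y.1.1,
    continuous_subtype_val.comp continuous_subtype_val⟩

lemma isStalkwisePullback_restrict_restrict {X : TopCat.{0}} (F : Shv X) (A : Set X)
    (U : Opens (TopCat.of A)) :
    IsStalkwisePullback (inclusion A U) F
      (restrict (restrict F A) (U : Set (TopCat.of A))) :=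
  (isStalkwisePullback_pullback _ F).comp (isStalkwisePullback_pullback _ _)

/-! ### Constant sheaves as globally framed sheaves -/

lemma isIso_germ_top_const {X : TopCat.{0}} (V : ModuleCat.{0} ℂ) (x : X) :
    IsIso (Presheaf.germ ((Functor.const (Opens X)ᵒᵖ).obj V : X.Presheaf (ModuleCat.{0} ℂ))
      ⊤ x (Opens.mem_top x)) := by
  rw [ConcreteCategory.isIso_iff_bijective]
  constructor
  · intro v w h
    obtain ⟨W, hW, i, j, h⟩ := Presheaf.germ_eq _ x _ _ v w h
    exact h
  · intro t
    obtain ⟨U, hU, v, rfl⟩ := Presheaf.exists_germ_eq _ t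
    refine ⟨v, ?_⟩
    have := Presheaf.germ_res_apply
      ((Functor.const (Opens X)ᵒᵖ).obj V : X.Presheaf (ModuleCat.{0} ℂ))
      (homOfLE le_top : U ⟶ ⊤) x hU v
    exact this.symm

/-- The family `s` induces a map from the constant sheaf, and isomorphisms of sheaves are detected
on stalks. -/
lemma isConstant_of_isIso_germ {X : TopCat.{0}} (F : Shv X) (V : ModuleCat.{0} ℂ)
    (s : V ⟶ F.presheaf.obj (op ⊤))
    (hs : ∀ x, IsIso (s ≫ F.presheaf.germ ⊤ x (Opens.mem_top x))) :
    Sheaf.IsConstant (Opens.grothendieckTopology X) F := by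
  let C : X.Presheaf (ModuleCat.{0} ℂ) := (Functor.const (Opens X)ᵒᵖ).obj V
  let θ : C ⟶ F.presheaf :=
    { app := fun U => s ≫ F.presheaf.map (homOfLE le_top).op
      naturality := fun U W i => by
        simp only [C, Functor.const_obj_map, Category.assoc, ← Functor.map_comp]
        exact Category.id_comp _ }
  let ψ : sheafify (Opens.grothendieckTopology X) C ⟶ F.presheaf :=
    sheafifyLift (Opens.grothendieckTopology X) θ F.2
  let φ : (constantSheaf (Opens.grothendieckTopology X) (ModuleCat.{0} ℂ)).obj V ⟶ F := ⟨ψ⟩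
  have hφ : toSheafify (Opens.grothendieckTopology X) C ≫ ψ = θ :=
    toSheafify_sheafifyLift ..
  have hst : ∀ x : X, IsIso ((Presheaf.stalkFunctor (ModuleCat.{0} ℂ) x).map ψ) := by
    intro x
    have h1 : IsIso ((Presheaf.stalkFunctor (ModuleCat.{0} ℂ) x).map
        (toSheafify (Opens.grothendieckTopology X) C)) :=
      Presheaf.stalkFunctor_map_unit_toSheafify_isIso ..
    have h2 : IsIso (Presheaf.germ C ⊤ x (Opens.mem_top x)) := isIso_germ_top_const V x
    have h3 : Presheaf.germ C ⊤ x (Opens.mem_top x) ≫ (Presheaf.stalkFunctor (ModuleCat.{0} ℂ) x).map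
        (toSheafify (Opens.grothendieckTopology X) C) ≫
          (Presheaf.stalkFunctor (ModuleCat.{0} ℂ) x).map ψ =
        s ≫ F.presheaf.germ ⊤ x (Opens.mem_top x) := by
      have h3 := (Presheaf.stalkFunctor (ModuleCat.{0} ℂ) x).map_comp
        (toSheafify (Opens.grothendieckTopology X) C) ψ
      rw [hφ] at h3
      refine (congrArg (fun k => Presheaf.germ C ⊤ x (Opens.mem_top x) ≫ k) h3.symm).trans ?_
      rw [Presheaf.stalkFunctor_map_germ]
      simp only [θ, Category.assoc]
      rw [Presheaf.germ_res]
    have h4 := hs x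
    rw [← h3] at h4
    have h5 := @IsIso.of_isIso_comp_left _ _ _ _ _ _ _ h2 h4
    exact @IsIso.of_isIso_comp_left _ _ _ _ _ _ _ h1 h5
  have : IsIso φ := (Presheaf.isIso_iff_stalkFunctor_map_iso (X := X)
    (F := (constantSheaf (Opens.grothendieckTopology X) (ModuleCat.{0} ℂ)).obj V)
    (G := F) φ).2 hst
  exact Sheaf.isConstant_of_iso _ (asIso φ).symm

lemma exists_isIso_germ_of_isConstant {X : TopCat.{0}} (F : Shv X)
    (h : Sheaf.IsConstant (Opens.grothendieckTopology X) F) :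
    ∃ (V : ModuleCat.{0} ℂ) (s : V ⟶ F.presheaf.obj (op ⊤)),
      ∀ x, IsIso (s ≫ F.presheaf.germ ⊤ x (Opens.mem_top x)) := by
  obtain ⟨V, ⟨i⟩⟩ := h.mem_essImage
  let C : X.Presheaf (ModuleCat.{0} ℂ) := (Functor.const (Opens X)ᵒᵖ).obj V
  let ψ : sheafify (Opens.grothendieckTopology X) C ⟶ F.presheaf := i.hom.1
  have hψ : IsIso ψ := ((sheafToPresheaf _ _).mapIso i).isIso_hom
  refine ⟨V, (toSheafify (Opens.grothendieckTopology X) C ≫ ψ).app (op ⊤), fun x => ?_⟩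
  have h1 : IsIso ((Presheaf.stalkFunctor (ModuleCat.{0} ℂ) x).map
      (toSheafify (Opens.grothendieckTopology X) C)) :=
    Presheaf.stalkFunctor_map_unit_toSheafify_isIso ..
  have h2 : IsIso (Presheaf.germ C ⊤ x (Opens.mem_top x)) := isIso_germ_top_const V x
  have h3 : IsIso ((Presheaf.stalkFunctor (ModuleCat.{0} ℂ) x).map
      (toSheafify (Opens.grothendieckTopology X) C ≫ ψ)) := by
    rw [Functor.map_comp]
    exact IsIso.comp_isIso' h1 inferInstance
  have := Presheaf.stalkFunctor_map_germ (C := ModuleCat.{0} ℂ) ⊤ x (Opens.mem_top x)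
    (toSheafify (Opens.grothendieckTopology X) C ≫ ψ)
  erw [← this]
  exact IsIso.comp_isIso' h2 h3

/-! ### Local constancy on a subset as existence of ambient frames -/

/-- `F` admits, near every point of `A`, a linear family of sections whose germs identify a fixed
vector space with all stalks at points of `A`. -/
def IsFramedOn {X : TopCat.{0}} (F : Shv X) (A : Set X) : Prop :=
  ∀ a ∈ A, ∃ (W : Opens X) (_ : a ∈ W) (V : ModuleCat.{0} ℂ) (s : V ⟶ F.presheaf.obj (op W)),
    ∀ (b : X) (hb : b ∈ W), b ∈ A → IsIso (s ≫ F.presheaf.germ W b hb)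

lemma IsStalkwisePullback.isConstant {X Y : TopCat.{0}} {k : Y ⟶ X} {F : Shv X} {G : Shv Y}
    (h : IsStalkwisePullback k F G) {W : Opens X} (hW : ∀ y, k y ∈ W) {V : ModuleCat.{0} ℂ}
    (s : V ⟶ F.presheaf.obj (op W))
    (hs : ∀ y, IsIso (s ≫ F.presheaf.germ W (k y) (hW y))) :
    Sheaf.IsConstant (Opens.grothendieckTopology Y) G := by
  obtain ⟨η, hη⟩ := h
  have hU : (⊤ : Opens Y) ≤ (Opens.map k).obj W := fun y _ => hW y
  refine isConstant_of_isIso_germ _ V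
    (s ≫ η W ≫ G.presheaf.map (homOfLE hU).op) fun y => ?_
  obtain ⟨e, he⟩ := hη y
  have h1 := hs y
  have h2 : (s ≫ η W ≫ G.presheaf.map (homOfLE hU).op) ≫
      G.presheaf.germ ⊤ y (Opens.mem_top y) = (s ≫ F.presheaf.germ W (k y) (hW y)) ≫ e.hom := by
    rw [Category.assoc, Category.assoc, Category.assoc, Presheaf.germ_res]
    exact congrArg (fun m => s ≫ m) (he W (hW y)).symm
  rw [h2]
  infer_instance

lemma isLocallyConstantSheaf_restrict_of_isFramedOn {X : TopCat.{0}} (F : Shv X) (A : Set X)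
    (h : IsFramedOn F A) : IsLocallyConstantSheaf (restrict F A) := by
  intro a
  obtain ⟨W, ha, V, s, hs⟩ := h a.1 a.2
  let U : Opens (TopCat.of A) := ⟨Subtype.val ⁻¹' (W : Set X), W.2.preimage continuous_subtype_val⟩
  exact ⟨U, ha, (isStalkwisePullback_restrict_restrict F A U).isConstant
    (fun y => y.2) s fun y => hs y.1.1 y.2 y.1.2⟩

/-- A germ of `t` lifts through the stalk isomorphism to a section of `F`. Agreement at `y` spreads
to an open subset of `Y`, which is the trace of an open subset of `X` because `k` is inducing. -/
lemma exists_section_extending {X Y : TopCat.{0}} {k : Y ⟶ X} (hk : Topology.IsInducing k)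
    {F : Shv X} {G : Shv Y}
    {η : ∀ W : Opens X, F.presheaf.obj (op W) ⟶ G.presheaf.obj (op ((Opens.map k).obj W))}
    {e : ∀ y : Y, F.presheaf.stalk (k y) ≅ G.presheaf.stalk y}
    (he : ∀ (y : Y) (W : Opens X) (hy : y ∈ (Opens.map k).obj W),
        F.presheaf.germ W (k y) hy ≫ (e y).hom =
          η W ≫ G.presheaf.germ ((Opens.map k).obj W) y hy)
    (t : G.presheaf.obj (op ⊤)) (y : Y) :
    ∃ (W : Opens X) (_ : k y ∈ W) (σ : F.presheaf.obj (op W)), ∀ (z : Y) (hz : k z ∈ W),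
      (e z).hom (F.presheaf.germ W (k z) hz σ) =
          G.presheaf.germ ⊤ z (Opens.mem_top z) t := by
  have he' : ∀ (y : Y) (W : Opens X) (hy : y ∈ (Opens.map k).obj W) (σ : F.presheaf.obj (op W)),
      (e y).hom (F.presheaf.germ W (k y) hy σ) =
        G.presheaf.germ ((Opens.map k).obj W) y hy (η W σ) := fun y W hy σ =>
    congrArg (fun m => m.hom σ) (he y W hy)
  obtain ⟨W₀, hW₀, σ₀, hσ₀⟩ := Presheaf.exists_germ_eq F.presheaf
    ((e y).inv (G.presheaf.germ ⊤ y (Opens.mem_top y) t))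
  have h1 : G.presheaf.germ ((Opens.map k).obj W₀) y hW₀ (η W₀ σ₀) =
      G.presheaf.germ ⊤ y (Opens.mem_top y) t := by
    refine (he' y W₀ hW₀ σ₀).symm.trans ?_
    rw [hσ₀]
    exact (e y).inv_hom_id_apply _
  obtain ⟨O, hyO, i, j, hO⟩ := Presheaf.germ_eq G.presheaf y _ _ _ _ h1
  obtain ⟨O', hO', hOO⟩ := hk.isOpen_iff.1 O.2
  have hmem : ∀ z, k z ∈ O' ↔ z ∈ O := fun z => by
    change z ∈ k ⁻¹' O' ↔ z ∈ O.carrier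
    rw [hOO]
  refine ⟨W₀ ⊓ ⟨O', hO'⟩, ⟨hW₀, (hmem y).2 hyO⟩, F.presheaf.map (homOfLE inf_le_left).op σ₀, ?_⟩
  intro z hz
  rw [Presheaf.germ_res_apply]
  have hzO : z ∈ O := (hmem z).1 hz.2
  refine (he' z W₀ hz.1 σ₀).trans ?_
  exact Presheaf.germ_ext G.presheaf O hzO i j hO

/-- Only finitely many basis sections have to be extended, so their domains have an open
intersection; this is where finite dimension enters. -/
lemma IsStalkwisePullback.exists_isIso_germ {X Y : TopCat.{0}} {k : Y ⟶ X}
    (hk : Topology.IsInducing k) {F : Shv X} {G : Shv Y} (h : IsStalkwisePullback k F G)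
    (hG : Sheaf.IsConstant (Opens.grothendieckTopology Y) G) (y : Y)
    (hfin : Module.Finite ℂ (F.presheaf.stalk (k y))) :
    ∃ (W : Opens X) (_ : k y ∈ W) (V : ModuleCat.{0} ℂ) (s : V ⟶ F.presheaf.obj (op W)),
      ∀ (z : Y) (hz : k z ∈ W), IsIso (s ≫ F.presheaf.germ W (k z) hz) := by
  obtain ⟨η, hη⟩ := h
  choose e he using hη
  obtain ⟨V, t, ht⟩ := exists_isIso_germ_of_isConstant G hG
  have hV : Module.Finite ℂ V :=
    Module.Finite.equiv ((e y) ≪≫ (@asIso _ _ _ _ _ (ht y)).symm).toLinearEquiv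
  let b := Module.finBasis ℂ V
  choose W hW σ hσ using fun i => exists_section_extending hk he (t (b i)) y
  let W' : Opens X := Finset.univ.inf W
  have hle : ∀ i, W' ≤ W i := fun i => Finset.inf_le (Finset.mem_univ i)
  let s : V →ₗ[ℂ] F.presheaf.obj (op W') :=
    b.constr ℂ fun i => F.presheaf.map (homOfLE (hle i)).op (σ i)
  have hyW : k y ∈ W' := by
    rw [← SetLike.mem_coe, Opens.coe_finset_inf]
    simpa using hW
  refine ⟨W', hyW, V, ModuleCat.ofHom s, fun z hz => ?_⟩
  have h1 : (ModuleCat.ofHom s ≫ F.presheaf.germ W' (k z) hz) ≫ (e z).hom =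
      t ≫ G.presheaf.germ ⊤ z (Opens.mem_top z) := by
    refine ModuleCat.hom_ext (b.ext fun i => ?_)
    change (e z).hom (F.presheaf.germ W' (k z) hz (s (b i))) =
      G.presheaf.germ ⊤ z (Opens.mem_top z) (t (b i))
    rw [b.constr_basis, Presheaf.germ_res_apply]
    exact hσ i z (hle i hz)
  have h2 := ht z
  rw [← h1] at h2
  exact IsIso.of_isIso_comp_right _ (e z).hom

lemma isFramedOn_of_isLocallyConstantSheaf_restrict {X : TopCat.{0}} (F : Shv X) (A : Set X)
    (hfin : ∀ x, Module.Finite ℂ (F.presheaf.stalk x))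
    (h : IsLocallyConstantSheaf (restrict F A)) : IsFramedOn F A := by
  intro a ha
  obtain ⟨U, haU, hU⟩ := h ⟨a, ha⟩
  have hk : Topology.IsInducing (inclusion A U) :=
    Topology.IsInducing.subtypeVal.comp Topology.IsInducing.subtypeVal
  obtain ⟨W, haW, V, s, hs⟩ := (isStalkwisePullback_restrict_restrict F A U).exists_isIso_germ hk hU
    ⟨⟨a, ha⟩, haU⟩ (hfin _)
  obtain ⟨O, hO, hOU⟩ := isOpen_induced_iff.1 U.2
  have hO' : ∀ b (hb : b ∈ A), b ∈ O → (⟨b, hb⟩ : A) ∈ U := by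
    intro b hb hbO
    have : (⟨b, hb⟩ : A) ∈ (Subtype.val ⁻¹' O : Set A) := hbO
    rwa [hOU] at this
  have haO : a ∈ O := by
    have : (⟨a, ha⟩ : A) ∈ U.carrier := haU
    rwa [← hOU] at this
  refine ⟨W ⊓ ⟨O, hO⟩, ⟨haW, haO⟩, V, s ≫ F.presheaf.map (homOfLE inf_le_left).op, ?_⟩
  intro b hb hbA
  rw [Category.assoc, Presheaf.germ_res]
  exact hs ⟨⟨b, hbA⟩, hO' b hbA hb.2⟩ hb.1

/-! ### Propagation of frames over connected sets -/

section Frames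

variable {X : TopCat.{0}} (F : Shv X)

/-- Over a connected base with framing `s'`, a family of sections `s` is a framing everywhere as soon
as it is one at a single point, because its matrix in the framing `s'` is constant. -/
lemma isIso_germ_of_isPreconnected {A : Type*} [TopologicalSpace A] {B : Set A}
    (hB : IsPreconnected B) {γ : A → X} (hγ : Continuous γ) {W W' : Opens X}
    {V V' : ModuleCat.{0} ℂ} (s : V ⟶ F.presheaf.obj (op W)) (s' : V' ⟶ F.presheaf.obj (op W'))
    (hW : ∀ z ∈ B, γ z ∈ W) (hW' : ∀ z ∈ B, γ z ∈ W')
    (hs' : ∀ z (hz : z ∈ B), IsIso (s' ≫ F.presheaf.germ W' (γ z) (hW' z hz)))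
    {a b : A} (ha : a ∈ B) (hb : b ∈ B)
    (hs : IsIso (s ≫ F.presheaf.germ W (γ a) (hW a ha))) :
    IsIso (s ≫ F.presheaf.germ W (γ b) (hW b hb)) := by
  let φ : ∀ z : B, V ⟶ V' := fun z =>
    (s ≫ F.presheaf.germ W (γ z) (hW z z.2)) ≫ @inv _ _ _ _ _ (hs' z z.2)
  have hφ : ∀ z : B, φ z ≫ s' ≫ F.presheaf.germ W' (γ z) (hW' z z.2) =
      s ≫ F.presheaf.germ W (γ z) (hW z z.2) := fun z => by
    have := hs' z z.2
    simp only [φ, Category.assoc, IsIso.inv_hom_id, Category.comp_id]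
  have hconst : ∀ v : V, φ ⟨a, ha⟩ v = φ ⟨b, hb⟩ v := by
    intro v
    have : PreconnectedSpace B := Subtype.preconnectedSpace hB
    refine IsLocallyConstant.apply_eq_of_preconnectedSpace (f := fun z : B => φ z v) ?_ _ _
    rw [IsLocallyConstant.iff_eventually_eq]
    intro z
    -- Equal germs at `γ z` stay equal nearby; injectivity of the frame `s'` there makes the
    -- coordinates of `s v` locally constant.
    have h1 : F.presheaf.germ W' (γ z) (hW' z z.2) (s' (φ z v)) =
        F.presheaf.germ W (γ z) (hW z z.2) (s v) := congrArg (fun m => m.hom v) (hφ z)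
    obtain ⟨O, hzO, i, j, hO⟩ := Presheaf.germ_eq F.presheaf (γ z) _ _ _ _ h1
    have hcont : Continuous fun z : B => γ z := hγ.comp continuous_subtype_val
    filter_upwards [(O.2.preimage hcont).mem_nhds hzO] with z' hz'
    have h2 := Presheaf.germ_ext F.presheaf O hz' i j hO
      (hxU := hW' z' z'.2) (hxV := hW z' z'.2)
    have h3 : F.presheaf.germ W' (γ z') (hW' z' z'.2) (s' (φ z' v)) =
        F.presheaf.germ W (γ z') (hW z' z'.2) (s v) := congrArg (fun m => m.hom v) (hφ z')
    have h4 := hs' z' z'.2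
    exact ((ConcreteCategory.isIso_iff_bijective _).1 h4).1 (h3.trans h2.symm)
  have hab : φ ⟨a, ha⟩ = φ ⟨b, hb⟩ := ConcreteCategory.hom_ext _ _ hconst
  have ha' := hs' a ha
  have hb' := hs' b hb
  have h5 : IsIso (φ ⟨a, ha⟩) := IsIso.comp_isIso' hs inferInstance
  rw [hab] at h5
  rw [← hφ ⟨b, hb⟩]
  exact IsIso.comp_isIso' h5 hb'

/-- No single frame covers `B`, but being a frame is a locally constant property: compare with a
local frame on a connected neighbourhood. -/
lemma isIso_germ_of_isFramedOn {A : Type*} [TopologicalSpace A] [LocallyConnectedSpace A]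
    {B : Set A} (hB : IsPreconnected B) (hBo : IsOpen B) {γ : A → X} (hγ : Continuous γ)
    {S : Set X} (hS : IsFramedOn F S) (hBS : ∀ z ∈ B, γ z ∈ S) {W : Opens X}
    {V : ModuleCat.{0} ℂ} (s : V ⟶ F.presheaf.obj (op W))
    (hW : ∀ z ∈ B, γ z ∈ W)
    {a b : A} (ha : a ∈ B) (hb : b ∈ B)
    (hs : IsIso (s ≫ F.presheaf.germ W (γ a) (hW a ha))) :
    IsIso (s ≫ F.presheaf.germ W (γ b) (hW b hb)) := by
  have : PreconnectedSpace B := Subtype.preconnectedSpace hB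
  have hloc : IsLocallyConstant fun z : B => IsIso (s ≫ F.presheaf.germ W (γ z) (hW z z.2)) := by
    rw [IsLocallyConstant.iff_eventually_eq]
    intro z
    obtain ⟨W', hzW', V', s', hs'⟩ := hS (γ z) (hBS z z.2)
    have hO : IsOpen (B ∩ γ ⁻¹' W') := hBo.inter (W'.2.preimage hγ)
    have hzO : (z : A) ∈ B ∩ γ ⁻¹' W' := ⟨z.2, hzW'⟩
    have hn : connectedComponentIn (B ∩ γ ⁻¹' W') (z : A) ∈ nhds (z : A) :=
      connectedComponentIn_mem_nhds (hO.mem_nhds hzO)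
    filter_upwards [continuous_subtype_val.continuousAt.preimage_mem_nhds hn] with z' hz'
    have hsub := connectedComponentIn_subset (B ∩ γ ⁻¹' W') (z : A)
    have key := fun {a b} ha hb => isIso_germ_of_isPreconnected F (a := a) (b := b)
      (isPreconnected_connectedComponentIn (F := B ∩ γ ⁻¹' W') (x := (z : A))) hγ s s'
      (fun z hz => hW z (hsub hz).1) (fun z hz => (hsub hz).2)
      (fun z hz => hs' (γ z) (hsub hz).2 (hBS z (hsub hz).1)) ha hb
    have hzz := mem_connectedComponentIn hzO
    exact propext ⟨key hz' hzz, key hzz hz'⟩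
  exact (hloc.apply_eq_of_preconnectedSpace ⟨a, ha⟩ ⟨b, hb⟩).mp hs

end Frames

/-! ### Strata along a complex line -/

lemma isPreconnected_ball_diff_center (c : ℂ) (r : ℝ) :
    IsPreconnected (Metric.ball c r \ {c}) := by
  have h : Metric.ball c r \ {c} =
      (fun p : ℝ × ℝ => c + p.1 * Complex.exp (p.2 * Complex.I)) '' (Set.Ioo 0 r ×ˢ Set.univ) := by
    ext z
    constructor
    · rintro ⟨hz, hzc⟩
      refine ⟨(‖z - c‖, Complex.arg (z - c)), ⟨⟨?_, ?_⟩, trivial⟩, ?_⟩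
      · exact norm_pos_iff.2 (sub_ne_zero.2 hzc)
      · simpa [dist_eq_norm] using hz
      · simp [Complex.norm_mul_exp_arg_mul_I]
    · rintro ⟨⟨ρ, θ⟩, ⟨⟨h0, h1⟩, -⟩, rfl⟩
      simp only at h0 h1
      refine ⟨?_, ?_⟩
      · simpa [dist_eq_norm, Complex.norm_exp_ofReal_mul_I, abs_of_pos h0] using h1
      · simpa using h0.ne'
  rw [h]
  exact (isPreconnected_Ioo.prod isPreconnected_univ).image _ (by fun_prop)

lemma IsComplexAnalyticSet.eventually_mem_or_eventually_notMem {N : ℕ} {Z : Set (Fin N → ℂ)}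
    (hZ : IsComplexAnalyticSet Z) (x : Fin N → ℂ) (c : ℂ) :
    (∀ᶠ z in nhdsWithin c {c}ᶜ, z • x ∈ Z) ∨ ∀ᶠ z in nhdsWithin c {c}ᶜ, z • x ∉ Z := by
  obtain ⟨U, hU, hcU, k, f, hf, hfZ⟩ := hZ (c • x)
  have hcont : Continuous fun z : ℂ => z • x := by fun_prop
  have hUn : ∀ᶠ z in nhdsWithin c {c}ᶜ, z • x ∈ U :=
    mem_nhdsWithin_of_mem_nhds ((hU.preimage hcont).mem_nhds hcU)
  have hγ : AnalyticAt ℂ (fun z : ℂ => z • x) c := by fun_prop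
  have hfγ : ∀ i, AnalyticAt ℂ (fun z : ℂ => f i (z • x)) c := fun i =>
    AnalyticAt.comp (f := fun z : ℂ => z • x) (hf i _ hcU) hγ
  -- Zeros of one-variable holomorphic functions are isolated: either some equation is nonzero on a
  -- punctured disc, or all vanish near `c`.
  by_cases h : ∃ i, ∀ᶠ z in nhdsWithin c {c}ᶜ, f i (z • x) ≠ 0
  · obtain ⟨i, hi⟩ := h
    right
    filter_upwards [hUn, hi] with z hz hzi hzZ
    exact hzi ((hfZ _ hz).1 hzZ i)
  · push Not at h
    left
    have h0 : ∀ i, ∀ᶠ z in nhdsWithin c {c}ᶜ, f i (z • x) = 0 := fun i =>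
      (((hfγ i).eventually_eq_zero_or_eventually_ne_zero).resolve_right
        (by simpa using h i)).filter_mono nhdsWithin_le_nhds
    filter_upwards [hUn, Filter.eventually_all.2 h0] with z hz hz0
    exact (hfZ _ hz).2 hz0

lemma IsAnalyticStratification.exists_eventually_mem {N : ℕ} {𝒮 : Set (Set (Fin N → ℂ))}
    (h𝒮 : IsAnalyticStratification 𝒮) (x : Fin N → ℂ) (c : ℂ) :
    ∃ S ∈ 𝒮, ∀ᶠ z in nhdsWithin c {c}ᶜ, z • x ∈ S := by
  have hcont : Continuous fun z : ℂ => z • x := by fun_prop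
  have hdich : ∀ S ∈ 𝒮, (∀ᶠ z in nhdsWithin c {c}ᶜ, z • x ∈ S) ∨
      ∀ᶠ z in nhdsWithin c {c}ᶜ, z • x ∉ S := by
    intro S hS
    rcases (h𝒮.closure_analytic S hS).eventually_mem_or_eventually_notMem x c with h1 | h1
    · rcases (h𝒮.boundary_analytic S hS).eventually_mem_or_eventually_notMem x c with h2 | h2
      · right
        filter_upwards [h2] with z hz using hz.2
      · left
        filter_upwards [h1, h2] with z hz hz' using by_contra fun h => hz' ⟨hz, h⟩
    · right
      filter_upwards [h1] with z hz hz' using hz (subset_closure hz')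
  obtain ⟨O, hO, hfin⟩ := h𝒮.locallyFinite (c • x)
  by_contra! hcon
  have hout : ∀ S ∈ 𝒮, ∀ᶠ z in nhdsWithin c {c}ᶜ, z • x ∉ S := fun S hS =>
    (hdich S hS).resolve_left (Filter.not_eventually.2 (hcon S hS))
  have hall : ∀ᶠ z in nhdsWithin c {c}ᶜ,
      ∀ S ∈ {S : 𝒮 | ((S : Set (Fin N → ℂ)) ∩ O).Nonempty}, z • x ∉ (S : Set (Fin N → ℂ)) :=
    hfin.eventually_all.2 fun S _ => hout S S.2
  have hOn : ∀ᶠ z in nhdsWithin c {c}ᶜ, z • x ∈ O :=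
    mem_nhdsWithin_of_mem_nhds (hcont.continuousAt.preimage_mem_nhds hO)
  obtain ⟨z, hz, hzO⟩ := (hall.and hOn).exists
  obtain ⟨S, ⟨hS, hzS⟩, -⟩ := h𝒮.isPartition.2 (z • x)
  exact hz ⟨S, hS⟩ ⟨_, hzS, hzO⟩ hzS

/-! ### Frames along a complex orbit -/

lemma isFramedOn_complexOrbit {N : ℕ} (F : Shv (affineSpace N)) {𝒮 : Set (Set (Fin N → ℂ))}
    (h𝒮 : IsAnalyticStratification 𝒮) (hF : ∀ S ∈ 𝒮, IsFramedOn F S)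
    (hconic : ∀ x : Fin N → ℂ, IsFramedOn F (posRealOrbit x))
    {x : Fin N → ℂ} (hx : x ≠ 0) : IsFramedOn F (complexOrbit x) := by
  rintro _ ⟨c, hc, rfl⟩
  obtain ⟨W, hcW, V, s, hs⟩ := hconic (c • x) (c • x) ⟨1, one_pos, by simp⟩
  obtain ⟨S, hS, hSc⟩ := h𝒮.exists_eventually_mem x c
  have hcont : Continuous fun z : ℂ => z • x := by fun_prop
  have hWn : ∀ᶠ z in nhds c, z • x ∈ W := hcont.continuousAt.preimage_mem_nhds (W.2.mem_nhds hcW)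
  obtain ⟨r, hr, hball⟩ := Metric.eventually_nhds_iff_ball.1
    ((eventually_nhdsWithin_iff.1 hSc).and hWn)
  obtain ⟨i, hi⟩ := Function.ne_iff.1 hx
  have hi' : x i ≠ 0 := hi
  have hcoord : Continuous fun y : affineSpace N => y i / x i :=
    (continuous_apply i).div_const _
  -- The coordinate `y i / x i` recovers `b` from `b • x`, so `W'` meets the orbit only at scalars
  -- in the disc.
  let W' : Opens (affineSpace N) := W ⊓ ⟨_, (Metric.isOpen_ball (x := c) (ε := r)).preimage hcoord⟩
  refine ⟨W', ⟨hcW, ?_⟩, V, s ≫ F.presheaf.map (homOfLE inf_le_left).op, ?_⟩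
  · simpa [hi'] using hr
  rintro _ hbW' ⟨b, hb, rfl⟩
  rw [Category.assoc, Presheaf.germ_res]
  have hbr : b ∈ Metric.ball c r := by
    have := hbW'.2
    simpa [hi'] using this
  by_cases hbc : b = c
  · subst hbc
    exact hs (b • x) hbW'.1 ⟨1, one_pos, by simp⟩
  -- a point of the ray through `c • x` in the punctured disc
  have hnear : ∀ᶠ t : ℝ in nhdsWithin 1 {1}ᶜ, 0 < t ∧ (t : ℂ) * c ∈ Metric.ball c r := by
    have hct : Continuous fun t : ℝ => (t : ℂ) * c := by fun_prop
    refine mem_nhdsWithin_of_mem_nhds (Filter.inter_mem (lt_mem_nhds one_pos) ?_)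
    exact (hct.continuousAt (x := 1)).preimage_mem_nhds
      (by simpa using Metric.ball_mem_nhds c hr)
  obtain ⟨t, ⟨ht, htr⟩, ht1⟩ := (hnear.and self_mem_nhdsWithin).exists
  have htc : (t : ℂ) * c ≠ c := by
    intro h
    exact ht1 (by exact_mod_cast mul_right_cancel₀ hc (h.trans (one_mul c).symm))
  exact isIso_germ_of_isFramedOn F (isPreconnected_ball_diff_center c r)
    (Metric.isOpen_ball.sdiff isClosed_singleton) hcont (hF S hS)
    (fun z hz => (hball z hz.1).1 hz.2) s (fun z hz => (hball z hz.1).2)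
    (a := t * c) (b := b) ⟨htr, htc⟩ ⟨hbr, hbc⟩
    (hs _ _ ⟨t, ht, mul_smul _ _ _⟩)

end ConicSheaf

theorem lemma2p1 (N : ℕ) [HasDerivedCategory.{w} (ConicSheaf.Shv (ConicSheaf.affineSpace N))]
    (G : DerivedCategory.Bounded (ConicSheaf.Shv (ConicSheaf.affineSpace N)))
    (hG : ConicSheaf.IsCConstructible G) (hconic : ConicSheaf.IsConic G) :
    ConicSheaf.IsMonodromic G := by
  intro j x
  by_cases hx : x = 0
  · have h := hconic j x
    have horb : ConicSheaf.complexOrbit x = ConicSheaf.posRealOrbit x := by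
      subst hx
      ext y
      simp only [ConicSheaf.complexOrbit, ConicSheaf.posRealOrbit, smul_zero, Set.mem_ofPred_eq]
      exact ⟨fun ⟨_, _, h⟩ => ⟨1, one_pos, h⟩, fun ⟨_, _, h⟩ => ⟨1, one_ne_zero, h⟩⟩
    rw [horb]
    exact h
  · obtain ⟨⟨𝒮, h𝒮, hloc⟩, hfin⟩ := hG
    have hfin' := fun x => hfin x j
    exact ConicSheaf.isLocallyConstantSheaf_restrict_of_isFramedOn _ _
      (ConicSheaf.isFramedOn_complexOrbit _ h𝒮
        (fun S hS => ConicSheaf.isFramedOn_of_isLocallyConstantSheaf_restrict _ _ hfin'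
          (hloc S hS j))
        (fun x => ConicSheaf.isFramedOn_of_isLocallyConstantSheaf_restrict _ _ hfin' (hconic j x))
        hx)
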